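/- Let $\&\colon[0,1]^2\to[0,1]$ be a continuous t-norm (a continuous, commutative, associative, monotone operation with unit $1$) with implication $p\to r=\bigvee\{q\mid p\& q\le r\}$. **Spaces.** A $[0,1]$-approach space is a set $X$ with a map $\delta\colon X\times 2^X\to[0,1]$ such that $\delta(x,\{x\})=1$, $\delta(x,\varnothing)=0$, $\delta(x,A\cup B)=\delta(x,A)\vee\delta(x,B)$ and $\big(\bigwedge_{b\in B}\delta(b,A)\big)\&\,\delta(x,B)\le\delta(x,A)$. A map $f\colon X\to Y$ is continuous if $\delta_X(x,A)\le\delta_Y(f(x),f(A))$ for all $x\in X$, $A\subseteq X$; a subspace carries the restricted structure. $Z$ is injective if every continuous map into $Z$ from a subspace of a $[0,1]$-approach space $X$ extends to a continuous map $X\to Z$. **Orders.** A $[0,1]$-order on $X$ is a map $X(\cdot,\cdot)\colon X\times X\to[0,1]$ with $X(x,x)=1$ and $X(y,z)\& X(x,y)\le X(x,z)$; it is separated if $X(x,y)=X(y,x)=1$ implies $x=y$. The specialization $[0,1]$-order $\Omega(X)$ of a $[0,1]$-approach space $(X,\delta)$ is $(x,y)\mapsto\delta(x,\{y\})$, and $(X,\delta)$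 is separated if $\Omega(X)$ is. Let ${\rm sub}(\phi,\psi)=\bigwedge_x(\phi(x)\to\psi(x))$. A weight of a $[0,1]$-ordered set $X$ is a map $\phi\colon X\to[0,1]$ with $\phi(y)\& X(x,y)\le\phi(x)$. An element $a$ is a supremum of $\phi$ if $X(a,y)={\rm sub}(\phi,X(-,y))$ for all $y$. $X$ is a complete $[0,1]$-lattice if it is separated and all weights of $X^{\rm op}$ (that is, $X$ with the order $(x,y)\mapsto X(y,x)$) have suprema in $X^{\rm op}$ (equivalently, it is separated and all weights of $X$ have suprema in $X$). A weight $\phi$ is forward Cauchy if $\phi=\bigvee_i\bigwedge_{j\ge i}X(-,x_j)$ for a net $(x_i)_i$ with $\bigvee_i\bigwedge_{i\le j\le l}X(x_j,x_l)=1$; the set $\mathcal DX$ of these weights is $[0,1]$-ordered by ${\rm sub}$, and ${\sf y}\colon X\to\mathcal DX$, $x\mapsto X(-,x)$. For maps $f\colon X\to Y$, $g\colon Y\to X$ between $[0,1]$-ordered sets write $f\dashv g$ if $Y(f(x),y)=X(x,g(y))$ for all $x,y$. A continuous $[0,1]$-lattice is a complete $[0,1]$-lattice $X$ for which there are maps $\sup\colon\mathcal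 DX\to X$ and ${\sf d}\colon X\to\mathcal DX$ with ${\sf d}\dashv\sup\dashv{\sf y}$. **Scott structure.** A map $f\colon X\to Y$ between $[0,1]$-ordered sets is $[0,1]$-Scott continuous if $X(x,y)\le Y(f(x),f(y))$ for all $x,y$ and, whenever $a$ is a supremum of a forward Cauchy weight $\phi$ of $X$, $f(a)$ is a supremum of the weight $y\mapsto\bigvee_x\phi(x)\& Y(y,f(x))$ of $Y$. A weight of $X$ is Scott closed if it is $[0,1]$-Scott continuous as a map from $X$ to $[0,1]$ with the $[0,1]$-order $(x,y)\mapsto(y\to x)$. The Scott $[0,1]$-approach space $\Sigma X$ is the set $X$ with the structure $$(x,A)\mapsto\bigwedge\{\phi(x)\mid \phi\text{ a Scott closed weight of }X,\ \phi(a)=1\text{ for all }a\in A\}.$$ **Theorem.** If $X$ is a separated and injective $[0,1]$-approach space, then $\Omega(X)$ is a continuous $[0,1]$-lattice and $X=\Sigma\Omega(X)$. -/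

import Mathlib

universe u v

/-- A continuous t-norm on `[0,1]`: a jointly continuous, commutative, associative, monotone
binary operation with unit `1`. -/
structure ContinuousTNorm where
  mul : unitInterval → unitInterval → unitInterval
  mul_comm : ∀ p q, mul p q = mul q p
  mul_assoc : ∀ p q r, mul (mul p q) r = mul p (mul q r)
  one_mul : ∀ p, mul 1 p = p
  mul_mono : ∀ p q r, q ≤ r → mul p q ≤ mul p r
  continuous_mul : Continuous fun z : unitInterval × unitInterval => mul z.1 z.2

namespace ContinuousTNorm

variable (T : ContinuousTNorm)

/-- The implication operator, i.e. the residuum of the t-norm (see `mul_le_iff`). -/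
noncomputable def imp (p r : unitInterval) : unitInterval := sSup {q | T.mul p q ≤ r}

/-- The fuzzy inclusion order on `[0,1]^X`. -/
noncomputable def sub {X : Type u} (φ ψ : X → unitInterval) : unitInterval :=
  ⨅ x, T.imp (φ x) (ψ x)

theorem mul_mono' {p p' q q' : unitInterval} (h : p ≤ p') (h' : q ≤ q') :
    T.mul p q ≤ T.mul p' q' := by
  refine (T.mul_mono p q q' h').trans ?_
  rw [T.mul_comm p, T.mul_comm p']
  exact T.mul_mono _ _ _ h

theorem mul_one (p : unitInterval) : T.mul p 1 = p := by rw [T.mul_comm, T.one_mul]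

theorem mul_zero (p : unitInterval) : T.mul p 0 = 0 := by
  apply le_antisymm _ unitInterval.nonneg'
  calc T.mul p 0 ≤ T.mul 1 0 := T.mul_mono' unitInterval.le_one' le_rfl
    _ = 0 := T.one_mul 0

theorem mul_le_iff (p q r : unitInterval) : T.mul p q ≤ r ↔ q ≤ T.imp p r := by
  constructor
  · exact fun h => le_sSup h
  · intro h
    have hc : IsClosed {q | T.mul p q ≤ r} :=
      isClosed_le (T.continuous_mul.comp (Continuous.prodMk_right p)) continuous_const
    have hm : T.imp p r ∈ {q | T.mul p q ≤ r} :=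
      hc.isCompact.sSup_mem ⟨0, by
        show T.mul p 0 ≤ r
        rw [T.mul_zero]
        exact unitInterval.nonneg'⟩
    exact (T.mul_mono _ _ _ h).trans hm

theorem mul_imp_le (p r : unitInterval) : T.mul p (T.imp p r) ≤ r :=
  (T.mul_le_iff _ _ _).2 le_rfl

theorem le_sub_iff {X : Type u} (φ ψ : X → unitInterval) (p : unitInterval) :
    p ≤ T.sub φ ψ ↔ ∀ x, T.mul (φ x) p ≤ ψ x := by
  simp only [sub, le_iInf_iff, mul_le_iff]

end ContinuousTNorm

/-- A `[0,1]`-order on `X`, with respect to the t-norm `T`. -/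
@[ext]
structure EnrichedOrder (T : ContinuousTNorm) (X : Type u) where
  rel : X → X → unitInterval
  refl : ∀ x, 1 ≤ rel x x
  trans : ∀ x y z, T.mul (rel y z) (rel x y) ≤ rel x z

namespace EnrichedOrder

variable {T : ContinuousTNorm} {X : Type u} {Y : Type v}

/-- The opposite `[0,1]`-order. -/
def op (α : EnrichedOrder T X) : EnrichedOrder T X where
  rel x y := α.rel y x
  refl := α.refl
  trans x y z := by
    rw [T.mul_comm]
    exact α.trans z y x

/-- Isomorphic elements are equal. -/
def IsSeparated (α : EnrichedOrder T X) : Prop :=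
  ∀ x y, 1 ≤ α.rel x y ⊓ α.rel y x → x = y

def PreservesOrder (α : EnrichedOrder T X) (β : EnrichedOrder T Y) (f : X → Y) : Prop :=
  ∀ x y, α.rel x y ≤ β.rel (f x) (f y)

/-- The map `f : X → Y` is left adjoint to `g : Y → X`. -/
def IsLeftAdjoint (α : EnrichedOrder T X) (β : EnrichedOrder T Y) (f : X → Y) (g : Y → X) :
    Prop :=
  ∀ x y, β.rel (f x) y = α.rel x (g y)

/-- The `[0,1]`-order `α_R` on `[0,1]`, `α_R(x,y) = y → x`. -/
noncomputable def alphaR (T : ContinuousTNorm) : EnrichedOrder T unitInterval where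
  rel x y := T.imp y x
  refl x := by rw [← T.mul_le_iff, T.mul_one]
  trans x y z := by
    rw [← T.mul_le_iff, ← T.mul_assoc]
    exact (T.mul_mono' (T.mul_imp_le _ _) le_rfl).trans (T.mul_imp_le _ _)

/-- The fuzzy inclusion `[0,1]`-order restricted to a set of maps `X → [0,1]`. -/
noncomputable def inclusion (T : ContinuousTNorm) (P : (X → unitInterval) → Prop) :
    EnrichedOrder T {φ : X → unitInterval // P φ} where
  rel φ ψ := T.sub φ.1 ψ.1
  refl φ := by
    rw [T.le_sub_iff]
    exact fun x => (T.mul_one _).le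
  trans φ ψ χ := by
    rw [T.le_sub_iff]
    intro x
    rw [T.mul_comm (T.sub ψ.1 χ.1), ← T.mul_assoc]
    exact (T.mul_mono' ((T.le_sub_iff _ _ _).1 le_rfl x) le_rfl).trans
      ((T.le_sub_iff _ _ _).1 le_rfl x)

def IsWeight (α : EnrichedOrder T X) (φ : X → unitInterval) : Prop :=
  ∀ x y, T.mul (φ y) (α.rel x y) ≤ φ x

/-- The element `a` is a supremum of the weight `φ`. -/
def IsSupremum (α : EnrichedOrder T X) (φ : X → unitInterval) (a : X) : Prop :=
  ∀ y, α.rel a y = T.sub φ (fun x => α.rel x y)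

def IsCocomplete (α : EnrichedOrder T X) : Prop :=
  ∀ φ, α.IsWeight φ → ∃ a, α.IsSupremum φ a

def IsComplete (α : EnrichedOrder T X) : Prop := α.op.IsCocomplete

/-- Separated and complete. -/
def IsCompleteLattice (α : EnrichedOrder T X) : Prop := α.IsSeparated ∧ α.IsComplete

def IsForwardCauchyNet (α : EnrichedOrder T X) {J : Type u} [Preorder J] (x : J → X) : Prop :=
  (⨆ i : J, ⨅ (j : J) (l : J) (_ : i ≤ j) (_ : j ≤ l), α.rel (x j) (x l)) = 1

/-- Nets are indexed by nonempty directed preordered sets in the universe of `X`. -/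
def IsForwardCauchyWeight (α : EnrichedOrder T X) (φ : X → unitInterval) : Prop :=
  α.IsWeight φ ∧ ∃ (J : Type u) (_ : Preorder J) (_ : Nonempty J)
    (_ : IsDirected J (fun i j => i ≤ j)) (x : J → X), α.IsForwardCauchyNet x ∧
      φ = fun y => ⨆ i : J, ⨅ (j : J) (_ : i ≤ j), α.rel y (x j)

/-- The set `𝒟X` of forward Cauchy weights. -/
abbrev ForwardCauchyWeight (α : EnrichedOrder T X) : Type u :=
  {φ : X → unitInterval // α.IsForwardCauchyWeight φ}

/-- The `[0,1]`-order of `𝒟X`. -/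
noncomputable def forwardCauchyOrder (α : EnrichedOrder T X) :
    EnrichedOrder T α.ForwardCauchyWeight :=
  inclusion T α.IsForwardCauchyWeight

/-- The Yoneda embedding `x ↦ X(-,x)`, as a map `X → 𝒟X`. -/
def yoneda (α : EnrichedOrder T X) (x : X) : α.ForwardCauchyWeight :=
  ⟨fun y => α.rel y x, fun y z => α.trans y z x, PUnit, inferInstance, inferInstance,
    inferInstance, fun _ => x, by
      apply le_antisymm unitInterval.le_one'
      simpa using α.refl x, by simp⟩

/-- A `[0,1]`-domain: separated, with adjunctions `d ⊣ sup ⊣ y : X → 𝒟X`. -/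
def IsDomain (α : EnrichedOrder T X) : Prop :=
  α.IsSeparated ∧ ∃ (s : α.ForwardCauchyWeight → X) (d : X → α.ForwardCauchyWeight),
    IsLeftAdjoint α.forwardCauchyOrder α s α.yoneda ∧
    IsLeftAdjoint α α.forwardCauchyOrder d s

def IsContinuousLattice (α : EnrichedOrder T X) : Prop :=
  α.IsCompleteLattice ∧ α.IsDomain

/-- The map `f^→` on weights: `f^→(φ)(y) = ⋁ₓ φ(x) & Y(y, f(x))`. -/
noncomputable def push (T : ContinuousTNorm) (β : EnrichedOrder T Y) (f : X → Y)
    (φ : X → unitInterval) : Y → unitInterval :=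
  fun y => ⨆ x, T.mul (φ x) (β.rel y (f x))

/-- An order-preserving map that preserves all existing suprema of forward Cauchy weights. -/
def IsScottContinuous (α : EnrichedOrder T X) (β : EnrichedOrder T Y) (f : X → Y) : Prop :=
  PreservesOrder α β f ∧ ∀ φ, α.IsForwardCauchyWeight φ → ∀ a, α.IsSupremum φ a →
    β.IsSupremum (push T β f φ) (f a)

/-- A Scott closed weight: a weight that is Scott continuous as a map `X → ([0,1], α_R)`. -/
def IsScottClosed (α : EnrichedOrder T X) (φ : X → unitInterval) : Prop :=
  α.IsWeight φ ∧ IsScottContinuous α (alphaR T) φ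

theorem isScottClosed_iff (α : EnrichedOrder T X) (φ : X → unitInterval) :
    α.IsScottClosed φ ↔ α.IsWeight φ ∧ ∀ ψ, α.IsForwardCauchyWeight ψ →
      ∀ a, α.IsSupremum ψ a → T.sub ψ φ ≤ φ a := by
  have key : ∀ (ψ : X → unitInterval) (y : unitInterval),
      T.sub (push T (alphaR T) φ ψ) (fun t => (alphaR T).rel t y) = T.imp y (T.sub ψ φ) := by
    intro ψ y
    refine eq_of_forall_le_iff fun c => ?_
    rw [T.le_sub_iff, ← T.mul_le_iff, T.le_sub_iff]
    simp only [push, alphaR, ← T.mul_le_iff]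
    constructor
    · intro h x
      have h1 := h (φ x)
      have h2 : ψ x ≤ ⨆ x', T.mul (ψ x') (T.imp (φ x') (φ x)) := by
        refine le_iSup_of_le x ?_
        have h3 : (1 : unitInterval) ≤ T.imp (φ x) (φ x) := by rw [← T.mul_le_iff, T.mul_one]
        exact (T.mul_one _).ge.trans (T.mul_mono _ _ _ h3)
      refine le_trans ?_ h1
      calc T.mul (ψ x) (T.mul y c) = T.mul y (T.mul (ψ x) c) := by
            rw [← T.mul_assoc, T.mul_comm (ψ x), T.mul_assoc]
        _ ≤ _ := T.mul_mono _ _ _ (T.mul_mono' h2 le_rfl)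
    · intro h t
      rw [← T.mul_assoc, T.mul_comm y, T.mul_assoc, T.mul_comm, T.mul_le_iff]
      refine iSup_le fun x => ?_
      rw [← T.mul_le_iff]
      calc T.mul (T.mul y c) (T.mul (ψ x) (T.imp (φ x) t))
          = T.mul (T.mul (ψ x) (T.mul y c)) (T.imp (φ x) t) := by
            rw [← T.mul_assoc, T.mul_comm (T.mul y c)]
        _ ≤ T.mul (φ x) (T.imp (φ x) t) := T.mul_mono' (h x) le_rfl
        _ ≤ t := T.mul_imp_le _ _
  constructor
  · rintro ⟨hw, -, h⟩
    refine ⟨hw, fun ψ hψ a ha => ?_⟩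
    have h1 := h ψ hψ a ha 1
    rw [key] at h1
    have h2 := T.mul_imp_le 1 (φ a)
    rw [T.one_mul] at h2
    refine le_trans ?_ h2
    show _ ≤ (alphaR T).rel (φ a) 1
    rw [h1, ← T.mul_le_iff, T.one_mul]
  · rintro ⟨hw, h⟩
    refine ⟨hw, fun x y => ?_, fun ψ hψ a ha y => ?_⟩
    · show _ ≤ T.imp (φ y) (φ x)
      rw [← T.mul_le_iff]
      exact hw x y
    · rw [key]
      show T.imp y (φ a) = _
      congr 1
      refine le_antisymm ?_ (h ψ hψ a ha)
      rw [T.le_sub_iff]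
      intro x
      have h1 : 1 ≤ T.sub ψ (fun x => α.rel x a) := (α.refl a).trans (ha a).le
      have h2 := (T.le_sub_iff _ _ _).1 h1 x
      rw [T.mul_one] at h2
      rw [T.mul_comm]
      exact (T.mul_mono _ _ _ h2).trans (hw x a)

theorem iSup_eq_one_of_isForwardCauchyWeight (α : EnrichedOrder T X) {φ : X → unitInterval}
    (h : α.IsForwardCauchyWeight φ) : ⨆ x, φ x = 1 := by
  obtain ⟨-, J, _, _, _, x, hx, rfl⟩ := h
  refine le_antisymm unitInterval.le_one' (hx.ge.trans ?_)
  refine iSup_le fun i => ?_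
  refine le_iSup_of_le (x i) (le_iSup_of_le i ?_)
  refine le_iInf₂ fun l hl => ?_
  exact iInf_le_of_le i (iInf_le_of_le l (iInf_le_of_le le_rfl (iInf_le_of_le hl le_rfl)))

theorem sub_sup_le_of_isForwardCauchyWeight (α : EnrichedOrder T X) {ψ φ₁ φ₂ : X → unitInterval}
    (h : α.IsForwardCauchyWeight ψ) (h₁ : α.IsWeight φ₁) (h₂ : α.IsWeight φ₂) :
    T.sub ψ (φ₁ ⊔ φ₂) ≤ T.sub ψ φ₁ ⊔ T.sub ψ φ₂ := by
  obtain ⟨-, J, _, _, _, x, hx, rfl⟩ := h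
  set ψ : X → unitInterval := fun y => ⨆ i : J, ⨅ (j : J) (_ : i ≤ j), α.rel y (x j) with hψ
  set s := T.sub ψ (φ₁ ⊔ φ₂) with hs
  let c : J → unitInterval := fun i =>
    ⨅ (j : J) (l : J) (_ : i ≤ j) (_ : j ≤ l), α.rel (x j) (x l)
  have hc : ⨆ i, c i = 1 := hx
  have cle : ∀ {i j l}, i ≤ j → j ≤ l → c i ≤ α.rel (x j) (x l) := fun {i j l} hj hl =>
    iInf_le_of_le j (iInf_le_of_le l (iInf_le_of_le hj (iInf_le_of_le hl le_rfl)))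
  have cmono : ∀ {i j}, i ≤ j → c i ≤ c j := fun {i j} hij =>
    le_iInf fun k => le_iInf fun l => le_iInf fun hk => le_iInf fun hl => cle (hij.trans hk) hl
  have cψ : ∀ i, c i ≤ ψ (x i) := fun i =>
    le_iSup_of_le i (le_iInf₂ fun l hl => cle le_rfl hl)
  have hor : ∀ i, T.mul (c i) s ≤ φ₁ (x i) ∨ T.mul (c i) s ≤ φ₂ (x i) := by
    intro i
    have h1 : T.mul (c i) s ≤ (φ₁ ⊔ φ₂) (x i) :=
      (T.mul_mono' (cψ i) le_rfl).trans ((T.le_sub_iff _ _ _).1 le_rfl (x i))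
    exact le_sup_iff.1 h1
  have main : ∀ φ : X → unitInterval, α.IsWeight φ →
      (∀ i, ∃ j, i ≤ j ∧ T.mul (c j) s ≤ φ (x j)) → s ≤ T.sub ψ φ := by
    intro φ hφ hcof
    rw [T.le_sub_iff]
    intro y
    rw [T.mul_comm, T.mul_le_iff]
    refine iSup_le fun i => ?_
    set m := ⨅ (j : J) (_ : i ≤ j), α.rel y (x j) with hm
    rw [← T.mul_le_iff]
    suffices hsuff : ⨆ k, c k ≤ T.imp (T.mul s m) (φ y) by
      rw [hc, ← T.mul_le_iff, T.mul_one] at hsuff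
      exact hsuff
    refine iSup_le fun k => ?_
    rw [← T.mul_le_iff]
    obtain ⟨n, hin, hkn⟩ := exists_ge_ge i k
    obtain ⟨j, hnj, hj⟩ := hcof n
    have hmj : m ≤ α.rel y (x j) := iInf₂_le j (hin.trans hnj)
    calc T.mul (T.mul s m) (c k) = T.mul (T.mul (c k) s) m := by
          rw [T.mul_comm, ← T.mul_assoc]
      _ ≤ T.mul (φ (x j)) (α.rel y (x j)) :=
          T.mul_mono' ((T.mul_mono' (cmono (hkn.trans hnj)) le_rfl).trans hj) hmj
      _ ≤ φ y := hφ y (x j)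
  by_cases hcase : ∀ i, ∃ j, i ≤ j ∧ T.mul (c j) s ≤ φ₁ (x j)
  · exact le_sup_of_le_left (main φ₁ h₁ hcase)
  · push Not at hcase
    obtain ⟨i, hi⟩ := hcase
    refine le_sup_of_le_right (main φ₂ h₂ fun k => ?_)
    obtain ⟨n, hin, hkn⟩ := exists_ge_ge i k
    exact ⟨n, hkn, (hor n).resolve_left (not_le.2 (hi n hin))⟩

end EnrichedOrder

/-- A `[0,1]`-cotopology on `X`. -/
structure EnrichedCotopology (T : ContinuousTNorm) (X : Type u) where
  closed : Set (X → unitInterval)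
  zero_mem : (fun _ => 0) ∈ closed
  sup_mem : ∀ φ ∈ closed, ∀ ψ ∈ closed, φ ⊔ ψ ∈ closed
  sInf_mem : ∀ S ⊆ closed, sInf S ∈ closed
  imp_mem : ∀ p, ∀ φ ∈ closed, (fun x => T.imp p (φ x)) ∈ closed

/-- A `[0,1]`-approach structure on `X`. -/
@[ext]
structure ApproachStructure (T : ContinuousTNorm) (X : Type u) where
  dist : X → Set X → unitInterval
  dist_singleton : ∀ x, 1 ≤ dist x {x}
  dist_empty : ∀ x, dist x ∅ = 0
  dist_union : ∀ x A B, dist x (A ∪ B) = dist x A ⊔ dist x B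
  dist_le : ∀ x A B, T.mul (⨅ b ∈ B, dist b A) (dist x B) ≤ dist x A

namespace EnrichedCotopology

variable {T : ContinuousTNorm} {X : Type u}

/-- The closure operator of a `[0,1]`-cotopology. -/
noncomputable def closure (τ : EnrichedCotopology T X) (μ : X → unitInterval) :
    X → unitInterval :=
  sInf {φ | φ ∈ τ.closed ∧ μ ≤ φ}

theorem closure_mem (τ : EnrichedCotopology T X) (μ : X → unitInterval) :
    τ.closure μ ∈ τ.closed :=
  τ.sInf_mem _ fun _ h => h.1

theorem le_closure (τ : EnrichedCotopology T X) (μ : X → unitInterval) : μ ≤ τ.closure μ :=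
  le_sInf fun _ h => h.2

theorem closure_le (τ : EnrichedCotopology T X) {μ φ : X → unitInterval} (h : φ ∈ τ.closed)
    (h' : μ ≤ φ) : τ.closure μ ≤ φ :=
  sInf_le ⟨h, h'⟩

theorem indicator_le_iff (A : Set X) (φ : X → unitInterval) :
    A.indicator (fun _ => (1 : unitInterval)) ≤ φ ↔ ∀ a ∈ A, 1 ≤ φ a := by
  classical
  constructor
  · intro h a ha
    have := h a
    rwa [Set.indicator_of_mem ha] at this
  · intro h a
    by_cases ha : a ∈ A
    · rw [Set.indicator_of_mem ha]
      exact h a ha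
    · rw [Set.indicator_of_notMem ha]
      exact unitInterval.nonneg'

/-- The `[0,1]`-approach structure of a `[0,1]`-cotopology: `(x, A)` is sent to the value at `x`
of the closure of the indicator function of `A`. -/
noncomputable def toApproach (τ : EnrichedCotopology T X) : ApproachStructure T X where
  dist x A := τ.closure (A.indicator fun _ => 1) x
  dist_singleton x := (indicator_le_iff {x} _).1 (τ.le_closure _) x rfl
  dist_empty x := by
    apply le_antisymm _ unitInterval.nonneg'
    exact τ.closure_le τ.zero_mem ((indicator_le_iff _ _).2 fun a ha => ha.elim) x
  dist_union x A B := by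
    have hA := (indicator_le_iff A _).1 (τ.le_closure (A.indicator fun _ => 1))
    have hB := (indicator_le_iff B _).1 (τ.le_closure (B.indicator fun _ => 1))
    have hAB := (indicator_le_iff (A ∪ B) _).1 (τ.le_closure ((A ∪ B).indicator fun _ => 1))
    apply le_antisymm
    · refine τ.closure_le (τ.sup_mem _ (τ.closure_mem (A.indicator fun _ => 1)) _
        (τ.closure_mem (B.indicator fun _ => 1))) ((indicator_le_iff _ _).2 ?_) x
      rintro a (ha | ha)
      · exact le_sup_of_le_left (hA a ha)
      · exact le_sup_of_le_right (hB a ha)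
    · refine sup_le ?_ ?_
      · exact τ.closure_le (τ.closure_mem _)
          ((indicator_le_iff _ _).2 fun a ha => hAB a (Or.inl ha)) x
      · exact τ.closure_le (τ.closure_mem _)
          ((indicator_le_iff _ _).2 fun a ha => hAB a (Or.inr ha)) x
  dist_le x A B := by
    rw [T.mul_le_iff]
    refine τ.closure_le (τ.imp_mem (⨅ b ∈ B, τ.closure (A.indicator fun _ => 1) b) _
      (τ.closure_mem (A.indicator fun _ => 1))) ((indicator_le_iff _ _).2 fun b hb => ?_) x
    rw [← T.mul_le_iff, T.mul_one]
    exact iInf₂_le b hb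

end EnrichedCotopology

namespace EnrichedOrder

variable {T : ContinuousTNorm} {X : Type u}

/-- The Scott `[0,1]`-cotopology: the closed sets are the Scott closed weights. -/
def scottCotopology (α : EnrichedOrder T X) : EnrichedCotopology T X where
  closed := {φ | α.IsScottClosed φ}
  zero_mem := by
    refine (α.isScottClosed_iff _).2 ⟨fun x y => ?_, fun ψ hψ a _ => ?_⟩
    · rw [T.mul_comm, T.mul_zero]
    · have h : ⨆ x, ψ x ≤ T.imp (T.sub ψ fun _ => 0) 0 := by
        refine iSup_le fun x => ?_
        rw [← T.mul_le_iff, T.mul_comm]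
        exact (T.le_sub_iff ψ (fun _ => 0) _).1 le_rfl x
      rw [α.iSup_eq_one_of_isForwardCauchyWeight hψ, ← T.mul_le_iff, T.mul_one] at h
      exact h
  sup_mem φ₁ h₁ φ₂ h₂ := by
    obtain ⟨hw₁, h₁⟩ := (α.isScottClosed_iff _).1 h₁
    obtain ⟨hw₂, h₂⟩ := (α.isScottClosed_iff _).1 h₂
    refine (α.isScottClosed_iff _).2 ⟨fun x y => ?_, fun ψ hψ a ha => ?_⟩
    · rcases le_total (φ₁ y) (φ₂ y) with h | h
      · rw [Pi.sup_apply, sup_eq_right.2 h]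
        exact le_sup_of_le_right (hw₂ x y)
      · rw [Pi.sup_apply, sup_eq_left.2 h]
        exact le_sup_of_le_left (hw₁ x y)
    · exact (α.sub_sup_le_of_isForwardCauchyWeight hψ hw₁ hw₂).trans
        (sup_le_sup (h₁ ψ hψ a ha) (h₂ ψ hψ a ha))
  sInf_mem S hS := by
    have hS' := fun φ hφ => (α.isScottClosed_iff φ).1 (hS hφ)
    refine (α.isScottClosed_iff _).2 ⟨fun x y => ?_, fun ψ hψ a ha => ?_⟩
    · rw [sInf_apply (a := x)]
      refine le_iInf fun φ => ?_
      have h : sInf S ≤ φ.1 := sInf_le φ.2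
      exact (T.mul_mono' (h y) le_rfl).trans ((hS' φ.1 φ.2).1 x y)
    · rw [sInf_apply]
      refine le_iInf fun φ => ?_
      have h : sInf S ≤ φ.1 := sInf_le φ.2
      refine le_trans ?_ ((hS' φ.1 φ.2).2 ψ hψ a ha)
      rw [T.le_sub_iff]
      exact fun x => ((T.le_sub_iff ψ (sInf S) _).1 le_rfl x).trans (h x)
  imp_mem p φ hφ := by
    obtain ⟨hw, h⟩ := (α.isScottClosed_iff _).1 hφ
    refine (α.isScottClosed_iff _).2 ⟨fun x y => ?_, fun ψ hψ a ha => ?_⟩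
    · rw [← T.mul_le_iff, ← T.mul_assoc]
      exact (T.mul_mono' (T.mul_imp_le _ _) le_rfl).trans (hw x y)
    · rw [← T.mul_le_iff]
      refine le_trans ?_ (h ψ hψ a ha)
      rw [T.le_sub_iff]
      intro x
      rw [← T.mul_assoc, T.mul_comm (ψ x), T.mul_assoc, T.mul_le_iff]
      exact (T.le_sub_iff ψ (fun x => T.imp p (φ x)) _).1 le_rfl x

/-- The Scott `[0,1]`-approach structure `Σ(X, α)`. -/
noncomputable def scottApproach (α : EnrichedOrder T X) : ApproachStructure T X :=
  α.scottCotopology.toApproach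

end EnrichedOrder

namespace ApproachStructure

variable {T : ContinuousTNorm} {X : Type u} {Y : Type v}

/-- The specialization `[0,1]`-order `Ω(X)`. -/
noncomputable def specialization (δ : ApproachStructure T X) : EnrichedOrder T X where
  rel x y := δ.dist x {y}
  refl := δ.dist_singleton
  trans x y z := by simpa using δ.dist_le x {z} {y}

def IsSeparated (δ : ApproachStructure T X) : Prop := δ.specialization.IsSeparated

/-- Continuity of maps between `[0,1]`-approach spaces. -/
def IsContinuous (δ : ApproachStructure T X) (ε : ApproachStructure T Y) (f : X → Y) : Prop :=
  ∀ x A, δ.dist x A ≤ ε.dist (f x) (f '' A)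

/-- The subspace structure on a subset `S` of `X`. -/
noncomputable def subspace (δ : ApproachStructure T X) (S : Set X) : ApproachStructure T S where
  dist x A := δ.dist x (Subtype.val '' A)
  dist_singleton x := by simpa using δ.dist_singleton (x : X)
  dist_empty x := by simpa using δ.dist_empty (x : X)
  dist_union x A B := by rw [Set.image_union, δ.dist_union]
  dist_le x A B := by
    have h := δ.dist_le x (Subtype.val '' A) (Subtype.val '' B)
    rwa [iInf_image] at h

/-- Injectivity: continuous maps extend along subspace inclusions. -/
def IsInjective {Z : Type u} (ε : ApproachStructure T Z) : Prop :=
  ∀ (X : Type u) (δ : ApproachStructure T X) (S : Set X) (f : S → Z),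
    IsContinuous (δ.subspace S) ε f →
      ∃ g : X → Z, IsContinuous δ ε g ∧ ∀ y : S, g y = f y

end ApproachStructure

/-! ### Residuation and strict inequalities for the t-norm. -/

namespace ContinuousTNorm

variable (T : ContinuousTNorm)

/-! Order the power `[0,1]^(2^X)` by reversed inclusion, so that suprema are weighted pointwise
infima. The map `e = δ.dist` into it is injective because `X` is separated, and its inverse is
continuous on the image for the Scott structure because evaluations are Scott closed. Injectivity of
`X` extends this inverse to a continuous retraction `r` (`IsInjective.exists_retract`). The rest is
transport along `r`.

A point `x` of the power is the supremum of the `w` way above it: those that differ from `1` in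
finitely many coordinates and are strictly larger than `x` there. By `powerOrder_rel_supremum_le`,
such `w` lie in any forward Cauchy weight at least to the degree to which `x` lies below its
supremum. On `X`, the left adjoint of `sup` sends `x` to the join of the `X(-, r w)` with `w` way
above `e x` (`isContinuousLattice_of_retract`).

For `X = ΣΩ(X)`, the functions `δ(-,A)` are Scott closed by `IsClosedFun.isScottClosed_of_retract`,
which gives one inequality. For the other, continuity of `e` into the Scott structure is replaced by
`isClosedFun_iInf_wayAbove`: if `f` is a weight of the power, the infimum of `f` over the points way
above `e x` is a closed function of `x`. With `f = φ ∘ r` and `φ` Scott closed, this function lies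
below `φ` and is `1` wherever `φ` is. -/

theorem mul_left_comm (p q r : unitInterval) : T.mul p (T.mul q r) = T.mul q (T.mul p r) := by
  rw [← T.mul_assoc, T.mul_comm p, T.mul_assoc]

theorem mul_sub_le {X : Type u} (φ ψ : X → unitInterval) (x : X) :
    T.mul (φ x) (T.sub φ ψ) ≤ ψ x :=
  (T.le_sub_iff _ _ _).1 le_rfl x

theorem iSup_mul_le_iff {ι : Sort v} (p : ι → unitInterval) (q r : unitInterval) :
    T.mul (⨆ i, p i) q ≤ r ↔ ∀ i, T.mul (p i) q ≤ r := by
  simp only [T.mul_comm _ q, T.mul_le_iff, iSup_le_iff]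

/-- This plays the role of an epsilon argument: `c i` is usually the Cauchy modulus of a net from
stage `i` on. -/
theorem le_of_iSup_eq_one {ι : Sort v} {c : ι → unitInterval} (hc : ⨆ i, c i = 1)
    {p q : unitInterval} (h : ∀ i, T.mul (c i) p ≤ q) : p ≤ q := by
  have := (T.iSup_mul_le_iff c p q).2 h
  rwa [hc, T.one_mul] at this

/-- Strict upper bounds for `q & s` persist when `s` is enlarged a little. -/
theorem exists_mul_lt {q s w : unitInterval} (h : T.mul q s < w) :
    ∃ s', (s' ≠ 1 → s < s') ∧ T.mul q s' < w := by
  by_cases hs : s = 1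
  -- Nothing exceeds `1`, so here `s' = 1` and the strictness clause is vacuous.
  · exact ⟨1, fun h => absurd rfl h, hs ▸ h⟩
  · have hlt : s < 1 := lt_of_le_of_ne unitInterval.le_one' hs
    have hU : {t | T.mul q t < w} ∈ nhds s :=
      (isOpen_lt (T.continuous_mul.comp (Continuous.prodMk_right q)) continuous_const).mem_nhds h
    obtain ⟨u, hu, hsub⟩ := exists_Ico_subset_of_mem_nhds hU ⟨1, hlt⟩
    obtain ⟨t, hst, htu⟩ := exists_between hu
    exact ⟨t, fun _ => hst, hsub ⟨hst.le, htu⟩⟩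

end ContinuousTNorm

/-! ### Weights, suprema and order retracts. -/

namespace EnrichedOrder

variable {T : ContinuousTNorm} {X : Type u} {Y : Type v}

theorem IsWeight.sub_rel {α : EnrichedOrder T X} {φ : X → unitInterval} (hφ : α.IsWeight φ)
    (x : X) : T.sub (fun y => α.rel y x) φ = φ x := by
  refine le_antisymm ?_ ((T.le_sub_iff _ _ _).2 fun y => ?_)
  · have h := T.mul_sub_le (fun y => α.rel y x) φ x
    rwa [le_antisymm unitInterval.le_one' (α.refl x), T.one_mul] at h
  · rw [T.mul_comm]
    exact hφ y x

theorem IsSupremum.le_rel {α : EnrichedOrder T X} {φ : X → unitInterval} {a : X}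
    (h : α.IsSupremum φ a) (x : X) : φ x ≤ α.rel x a := by
  have h1 := (T.le_sub_iff _ _ _).1 ((α.refl a).trans (h a).le) x
  rwa [T.mul_one] at h1

theorem IsSupremum.unique {α : EnrichedOrder T X} (hα : α.IsSeparated) {φ : X → unitInterval}
    {a b : X} (ha : α.IsSupremum φ a) (hb : α.IsSupremum φ b) : a = b := by
  refine hα a b (le_inf ?_ ?_)
  · rw [ha b, ← hb b]
    exact α.refl b
  · rw [hb a, ← ha a]
    exact α.refl a

theorem le_push (β : EnrichedOrder T Y) (f : X → Y) (φ : X → unitInterval) (x : X) :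
    φ x ≤ push T β f φ (f x) := by
  refine le_iSup_of_le x ?_
  rw [le_antisymm unitInterval.le_one' (β.refl (f x)), T.mul_one]

theorem isWeight_push (β : EnrichedOrder T Y) (f : X → Y) (φ : X → unitInterval) :
    β.IsWeight (push T β f φ) := by
  intro y z
  refine (T.iSup_mul_le_iff _ _ _).2 fun x => le_iSup_of_le x ?_
  rw [T.mul_assoc]
  exact T.mul_mono _ _ _ (β.trans _ _ _)

/-- `push T β f φ` is the least weight whose composite with `f` dominates `φ`; this is the graded
form of that universal property. -/
theorem sub_push {β : EnrichedOrder T Y} (f : X → Y) (φ : X → unitInterval)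
    {ψ : Y → unitInterval} (hψ : β.IsWeight ψ) :
    T.sub (push T β f φ) ψ = T.sub φ (fun x => ψ (f x)) := by
  refine le_antisymm ((T.le_sub_iff _ _ _).2 fun x => ?_) ((T.le_sub_iff _ _ _).2 fun y => ?_)
  · exact (T.mul_mono' (le_push β f φ x) le_rfl).trans (T.mul_sub_le _ _ _)
  · refine (T.iSup_mul_le_iff _ _ _).2 fun x => ?_
    rw [T.mul_comm (φ x), T.mul_assoc, T.mul_comm]
    exact (T.mul_mono' (T.mul_sub_le φ (fun x => ψ (f x)) x) le_rfl).trans (hψ y (f x))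

theorem isWeight_iSup_rel (α : EnrichedOrder T X) {J : Type*} (x : J → X) :
    α.IsWeight fun y => ⨆ j, α.rel y (x j) := fun y z =>
  (T.iSup_mul_le_iff _ _ _).2 fun j => le_iSup_of_le j (α.trans y z (x j))

/-- The Yoneda identity `IsWeight.sub_rel`, applied to each representable in the join. -/
theorem sub_iSup_rel {α : EnrichedOrder T X} {J : Type*} (x : J → X) {φ : X → unitInterval}
    (hφ : α.IsWeight φ) : T.sub (fun y => ⨆ j, α.rel y (x j)) φ = ⨅ j, φ (x j) := by
  refine eq_of_forall_le_iff fun c => ?_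
  rw [T.le_sub_iff, le_iInf_iff]
  simp only [T.iSup_mul_le_iff]
  rw [forall_comm]
  refine forall_congr' fun j => ?_
  rw [← hφ.sub_rel (x j), T.le_sub_iff]

theorem isForwardCauchyWeight_iSup_rel (α : EnrichedOrder T X) {J : Type u} [Preorder J]
    [Nonempty J] [IsDirected J (fun i j => i ≤ j)] (x : J → X)
    (hx : ∀ i j, i ≤ j → 1 ≤ α.rel (x i) (x j)) :
    α.IsForwardCauchyWeight fun y => ⨆ j, α.rel y (x j) := by
  refine ⟨α.isWeight_iSup_rel x, J, inferInstance, inferInstance, inferInstance, x, ?_, ?_⟩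
  · refine le_antisymm unitInterval.le_one' ?_
    obtain ⟨i⟩ := ‹Nonempty J›
    exact le_iSup_of_le i (le_iInf fun j => le_iInf fun l => le_iInf fun _ => le_iInf (hx j l))
  · funext y
    refine iSup_congr fun i => le_antisymm (le_iInf₂ fun j hij => ?_) (iInf₂_le i le_rfl)
    calc α.rel y (x i) = T.mul 1 (α.rel y (x i)) := (T.one_mul _).symm
      _ ≤ T.mul (α.rel (x i) (x j)) (α.rel y (x i)) := T.mul_mono' (hx i j hij) le_rfl
      _ ≤ α.rel y (x j) := α.trans _ _ _

theorem IsForwardCauchyWeight.push {α : EnrichedOrder T X} {Y : Type u} {β : EnrichedOrder T Y}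
    {f : X → Y} (hf : PreservesOrder α β f) {φ : X → unitInterval}
    (hφ : α.IsForwardCauchyWeight φ) : β.IsForwardCauchyWeight (push T β f φ) := by
  refine ⟨isWeight_push β f φ, ?_⟩
  obtain ⟨-, J, _, _, _, x, hx, rfl⟩ := hφ
  refine ⟨J, inferInstance, inferInstance, inferInstance, fun j => f (x j), ?_, ?_⟩
  · refine le_antisymm unitInterval.le_one' (hx.ge.trans (iSup_mono fun i => ?_))
    exact iInf_mono fun j => iInf_mono fun l => iInf_mono fun _ => iInf_mono fun _ => hf _ _
  · funext y
    refine le_antisymm (iSup_le fun z => ?_) (iSup_le fun k => ?_)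
    · refine (T.iSup_mul_le_iff _ _ _).2 fun k => le_iSup_of_le k (le_iInf₂ fun j hj => ?_)
      exact (T.mul_mono' ((iInf₂_le j hj).trans (hf _ _)) le_rfl).trans (β.trans _ _ _)
    -- For `j` beyond `i`, the modulus at `i` is at most `φ (x j)`, so `x j` is a good enough
    -- witness.
    · refine T.le_of_iSup_eq_one hx fun i => ?_
      obtain ⟨j, hkj, hij⟩ := exists_ge_ge k i
      refine le_iSup_of_le (x j) (T.mul_mono' ?_ (iInf₂_le j hkj))
      refine le_iSup_of_le j (le_iInf₂ fun l hl => ?_)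
      exact iInf_le_of_le j (iInf_le_of_le l (iInf_le_of_le hij (iInf_le _ hl)))

/-- Retractions preserve suprema. -/
theorem IsSupremum.of_retract {α : EnrichedOrder T X} {β : EnrichedOrder T Y} {e : X → Y}
    {r : Y → X} (he : PreservesOrder α β e) (hr : PreservesOrder β α r)
    (hre : ∀ x, r (e x) = x) {φ : X → unitInterval} {s : Y}
    (hs : β.IsSupremum (EnrichedOrder.push T β e φ) s) : α.IsSupremum φ (r s) := by
  intro y
  refine le_antisymm ((T.le_sub_iff _ _ _).2 fun x => ?_) ?_
  · rw [T.mul_comm]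
    refine (T.mul_mono _ _ _ ?_).trans (α.trans x (r s) y)
    calc φ x ≤ β.rel (e x) s := (le_push β e φ x).trans (hs.le_rel _)
      _ ≤ α.rel (r (e x)) (r s) := hr _ _
      _ = _ := by rw [hre]
  · calc T.sub φ (fun x => α.rel x y) ≤ T.sub φ (fun x => β.rel (e x) (e y)) :=
          (T.le_sub_iff _ _ _).2 fun x => (T.mul_sub_le φ _ x).trans (he x y)
      _ = β.rel s (e y) := by
          rw [hs, sub_push (β := β) e φ (ψ := fun z => β.rel z (e y)) fun z w => β.trans z w (e y)]
      _ ≤ α.rel (r s) (r (e y)) := hr _ _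
      _ = _ := by rw [hre]

theorem IsCocomplete.of_retract {α : EnrichedOrder T X} {β : EnrichedOrder T Y}
    (hβ : β.IsCocomplete) {e : X → Y} {r : Y → X} (he : PreservesOrder α β e)
    (hr : PreservesOrder β α r) (hre : ∀ x, r (e x) = x) : α.IsCocomplete := fun φ _ =>
  let ⟨s, hs⟩ := hβ _ (isWeight_push β e φ)
  ⟨r s, hs.of_retract he hr hre⟩

theorem PreservesOrder.op {α : EnrichedOrder T X} {β : EnrichedOrder T Y} {f : X → Y}
    (hf : PreservesOrder α β f) : PreservesOrder α.op β.op f := fun x y => hf y x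

/-! ### Powers of the unit interval and approximation in them. -/

/-- The power `[0,1]^I` of `([0,1], α_R)`. -/
noncomputable def powerOrder (T : ContinuousTNorm) (I : Type u) :
    EnrichedOrder T (I → unitInterval) where
  rel x y := T.sub y x
  refl x := (T.le_sub_iff _ _ _).2 fun _ => (T.mul_one _).le
  trans x y z := by
    rw [T.le_sub_iff]
    intro i
    rw [← T.mul_assoc]
    exact (T.mul_mono' (T.mul_sub_le z y i) le_rfl).trans (T.mul_sub_le y x i)

theorem powerOrder_rel_of_le (T : ContinuousTNorm) {I : Type u} {x y : I → unitInterval}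
    (h : y ≤ x) : 1 ≤ (powerOrder T I).rel x y :=
  (T.le_sub_iff _ _ _).2 fun i => (T.mul_one _).le.trans (h i)

theorem powerOrder_isSupremum (T : ContinuousTNorm) {I : Type u}
    (φ : (I → unitInterval) → unitInterval) :
    (powerOrder T I).IsSupremum φ fun i => T.sub φ fun x => x i := by
  intro y
  refine eq_of_forall_le_iff fun c => ?_
  simp only [powerOrder, T.le_sub_iff, T.mul_left_comm (φ _)]
  exact forall_comm

theorem powerOrder_isComplete (T : ContinuousTNorm) (I : Type u) :
    (powerOrder T I).IsComplete := by
  refine fun φ _ => ⟨fun i => ⨆ x, T.mul (φ x) (x i), fun y => ?_⟩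
  refine eq_of_forall_le_iff fun c => ?_
  simp only [powerOrder, op, T.le_sub_iff, T.iSup_mul_le_iff, T.mul_assoc, T.mul_left_comm]
  exact forall_comm

theorem powerOrder_isWeight_eval (T : ContinuousTNorm) {I : Type u} (i : I) :
    (powerOrder T I).IsWeight fun x => x i := fun x y => T.mul_sub_le y x i

theorem powerOrder_isScottClosed_eval (T : ContinuousTNorm) {I : Type u} (i : I) :
    (powerOrder T I).IsScottClosed fun x => x i := by
  refine (isScottClosed_iff _ _).2 ⟨powerOrder_isWeight_eval T i, fun ψ _ a ha => ?_⟩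
  have h : 1 ≤ (powerOrder T I).rel a fun i => T.sub ψ fun x => x i := by
    rw [ha, ← powerOrder_isSupremum T ψ]
    exact (powerOrder T I).refl _
  have h1 := (T.le_sub_iff _ _ _).1 h i
  rwa [T.mul_one] at h1

/-- `w` is way above `x` in `[0,1]^I`: it has only finitely many coordinates different from `1`,
and these are strictly above those of `x`. -/
def WayAbove {I : Type u} (x w : I → unitInterval) : Prop :=
  {i | w i ≠ 1}.Finite ∧ ∀ i, w i ≠ 1 → x i < w i

theorem WayAbove.inf {I : Type u} {x w w' : I → unitInterval} (h : WayAbove x w)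
    (h' : WayAbove x w') : WayAbove x (w ⊓ w') := by
  have key : ∀ i, (w ⊓ w') i = w i ∨ (w ⊓ w') i = w' i := fun i => by
    rcases le_total (w i) (w' i) with hi | hi
    · exact .inl (inf_eq_left.2 hi)
    · exact .inr (inf_eq_right.2 hi)
  refine ⟨(h.1.union h'.1).subset fun i hi => ?_, fun i hi => ?_⟩
  · rcases key i with hk | hk
    · exact .inl fun h => hi (hk.trans h)
    · exact .inr fun h => hi (hk.trans h)
  · rcases key i with hk | hk
    · rw [hk] at hi ⊢
      exact h.2 i hi
    · rw [hk] at hi ⊢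
      exact h'.2 i hi

theorem wayAbove_one {I : Type u} (x : I → unitInterval) : WayAbove x 1 := by
  constructor
  · simp
  · intro i hi
    exact absurd rfl hi

theorem wayAbove_update {I : Type u} [DecidableEq I] {x : I → unitInterval} {i : I}
    {p : unitInterval} (h : x i < p) : WayAbove x (Function.update 1 i p) := by
  refine ⟨(Set.finite_singleton i).subset fun j hj => ?_, fun j hj => ?_⟩
  · by_contra hne
    exact hj (Function.update_of_ne hne _ _)
  · by_cases hne : j = i
    · subst hne
      rwa [Function.update_self]
    · exact absurd (Function.update_of_ne hne _ _) hj

/-- Points that differ from `1` in the single coordinate `i` suffice, by density of `[0,1]`. -/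
theorem le_apply_of_forall_wayAbove {I : Type u} {x : I → unitInterval} {i : I}
    {p : unitInterval} (h : ∀ w, WayAbove x w → p ≤ w i) : p ≤ x i := by
  classical
  refine le_of_forall_gt_imp_ge_of_dense fun q hq => ?_
  simpa using h _ (wayAbove_update hq)

/-- The order dual appears because pointwise smaller means larger in `powerOrder`. -/
instance {I : Type u} (x : I → unitInterval) :
    Nonempty {w : I → unitInterval // WayAbove x w}ᵒᵈ := ⟨OrderDual.toDual ⟨1, wayAbove_one x⟩⟩

instance {I : Type u} (x : I → unitInterval) :
    IsDirected {w : I → unitInterval // WayAbove x w}ᵒᵈ (fun i j => i ≤ j) :=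
  ⟨fun v w => ⟨OrderDual.toDual ⟨_, v.ofDual.2.inf w.ofDual.2⟩,
    show v.ofDual.1 ⊓ w.ofDual.1 ≤ v.ofDual.1 from inf_le_left,
    show v.ofDual.1 ⊓ w.ofDual.1 ≤ w.ofDual.1 from inf_le_right⟩⟩

/-- The points way above `x` approximate `x`. -/
theorem powerOrder_rel_supremum_le {I : Type u} {ψ : (I → unitInterval) → unitInterval}
    (hψ : (powerOrder T I).IsForwardCauchyWeight ψ) {x w : I → unitInterval}
    (hw : WayAbove x w) :
    (powerOrder T I).rel x (fun i => T.sub ψ fun x => x i) ≤ ψ w := by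
  obtain ⟨-, J, _, _, _, y, -, rfl⟩ := hψ
  set ψ : (I → unitInterval) → unitInterval := fun z =>
    ⨆ i : J, ⨅ (j : J) (_ : i ≤ j), (powerOrder T I).rel z (y j)
  set q := (powerOrder T I).rel x (fun i => T.sub ψ fun x => x i)
  -- The gap below `w i` leaves room to enlarge the `i`-th coordinate of the supremum to some `s`,
  -- and the net is eventually at most `s` in that coordinate.
  have hev : ∀ i, w i ≠ 1 → ∃ k, ∀ j, k ≤ j → T.mul q (y j i) ≤ w i := by
    intro i hi
    have h1 : T.mul q (T.sub ψ fun x => x i) < w i := by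
      rw [T.mul_comm]
      exact (T.mul_sub_le (fun i => T.sub ψ fun x => x i) x i).trans_lt (hw.2 i hi)
    obtain ⟨s, hs, hqs⟩ := T.exists_mul_lt h1
    suffices h : ∃ k, ∀ j, k ≤ j → y j i ≤ s from
      h.imp fun k hk j hj => (T.mul_mono _ _ _ (hk j hj)).trans hqs.le
    by_cases hs1 : s = 1
    · obtain ⟨k⟩ := ‹Nonempty J›
      exact ⟨k, fun j _ => hs1 ▸ unitInterval.le_one'⟩
    · by_contra! hcof
      -- Exceeding `s` cofinally would force the `i`-th coordinate of the supremum to be at least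
      -- `s`.
      refine (hs hs1).not_ge ((T.le_sub_iff _ _ _).2 fun z => ?_)
      refine (T.iSup_mul_le_iff _ _ _).2 fun k => ?_
      obtain ⟨j, hkj, hj⟩ := hcof k
      refine (T.mul_mono' (iInf₂_le j hkj) hj.le).trans ?_
      rw [T.mul_comm]
      exact T.mul_sub_le (y j) z i
  choose! k hk using hev
  obtain ⟨m, hm⟩ : ∃ m, ∀ i ∈ {i | w i ≠ 1}, k i ≤ m := by
    obtain ⟨m, hm⟩ := (hw.1.image k).bddAbove
    exact ⟨m, fun i hi => hm (Set.mem_image_of_mem k hi)⟩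
  refine le_iSup_of_le m (le_iInf₂ fun j hj => (T.le_sub_iff _ _ _).2 fun i => ?_)
  by_cases hi : w i = 1
  · exact hi ▸ unitInterval.le_one'
  · rw [T.mul_comm]
    exact hk i hi j ((hm i hi).trans hj)

theorem le_scottApproach_dist_iff {α : EnrichedOrder T X} {x : X} {A : Set X}
    {c : unitInterval} : c ≤ α.scottApproach.dist x A ↔
      ∀ φ, α.IsScottClosed φ → (∀ a ∈ A, 1 ≤ φ a) → c ≤ φ x := by
  change c ≤ (sInf {φ | α.IsScottClosed φ ∧ _ ≤ φ} : X → unitInterval) x ↔ _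
  rw [sInf_apply, le_iInf_iff]
  simp only [Subtype.forall, Set.mem_ofPred_eq, EnrichedCotopology.indicator_le_iff, and_imp]

end EnrichedOrder

/-! ### Closed functions on approach spaces. -/

namespace ApproachStructure

open EnrichedOrder

variable {T : ContinuousTNorm} {X : Type u} {Y : Type v}

/-- A `[0,1]`-valued function is closed if it is continuous to the `[0,1]`-approach space
`[0,1]` with `δ(x,A) = ⋀ A → x` for nonempty `A`. -/
def IsClosedFun (δ : ApproachStructure T X) (φ : X → unitInterval) : Prop :=
  ∀ x A, T.mul (⨅ a ∈ A, φ a) (δ.dist x A) ≤ φ x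

theorem isClosedFun_dist (δ : ApproachStructure T X) (A : Set X) :
    δ.IsClosedFun fun x => δ.dist x A := fun x B => δ.dist_le x A B

theorem IsClosedFun.isWeight {δ : ApproachStructure T X} {φ : X → unitInterval}
    (h : δ.IsClosedFun φ) : δ.specialization.IsWeight φ := fun x y => by
  have h1 := h x {y}
  rwa [iInf_singleton] at h1

theorem IsClosedFun.comp {δ : ApproachStructure T X} {ε : ApproachStructure T Y}
    {φ : Y → unitInterval} (h : ε.IsClosedFun φ) {f : X → Y} (hf : δ.IsContinuous ε f) :
    δ.IsClosedFun fun x => φ (f x) := fun x A => by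
  refine le_trans ?_ (h (f x) (f '' A))
  rw [iInf_image]
  exact T.mul_mono _ _ _ (hf x A)

theorem dist_mono (δ : ApproachStructure T X) (x : X) {A B : Set X} (h : A ⊆ B) :
    δ.dist x A ≤ δ.dist x B := by
  rw [← Set.union_eq_self_of_subset_left h, δ.dist_union]
  exact le_sup_left

/-- Finite additivity together with linearity of `[0,1]`; the value `0` covers the empty family. -/
theorem exists_dist_le_of_subset_biUnion (δ : ApproachStructure T X) {I : Type*} {F : Set I}
    (hF : F.Finite) (x : X) {A : Set X} (B : I → Set X) (hA : A ⊆ ⋃ i ∈ F, B i) :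
    δ.dist x A = 0 ∨ ∃ i ∈ F, δ.dist x A ≤ δ.dist x (B i) := by
  induction F, hF using Set.Finite.induction_on generalizing A with
  | empty =>
    left
    have hA' : A = ∅ := Set.subset_empty_iff.1 (by simpa using hA)
    rw [hA', δ.dist_empty]
  | @insert i F _ _ ih =>
    rw [Set.biUnion_insert] at hA
    have h1 : δ.dist x A ≤ δ.dist x (B i) ⊔ δ.dist x (A \ B i) := by
      rw [← δ.dist_union]
      refine δ.dist_mono x fun a ha => ?_
      by_cases h : a ∈ B i
      · exact .inl h
      · exact .inr ⟨ha, h⟩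
    rcases le_sup_iff.1 h1 with h | h
    · exact .inr ⟨i, Set.mem_insert _ _, h⟩
    · rcases ih (A := A \ B i) fun a ha => (hA ha.1).resolve_left ha.2 with h2 | ⟨j, hj, h2⟩
      · exact .inl (le_antisymm (h.trans h2.le) unitInterval.nonneg')
      · exact .inr ⟨j, Set.mem_insert_of_mem _ hj, h.trans h2⟩

/-- Closed functions for the Scott structure are Scott closed. -/
theorem IsClosedFun.isScottClosed {α : EnrichedOrder T X} {φ : X → unitInterval}
    (h : α.scottApproach.IsClosedFun φ) : α.IsScottClosed φ := by
  refine (isScottClosed_iff _ _).2 ⟨fun x y => ?_, fun ψ hψ a ha => ?_⟩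
  · refine (T.mul_mono _ _ _ ?_).trans (h.isWeight x y)
    refine le_scottApproach_dist_iff.2 fun ζ hζ h1 => ?_
    have h2 := hζ.1 x y
    rwa [le_antisymm unitInterval.le_one' (h1 y rfl), T.one_mul] at h2
  · have hψ' := hψ
    obtain ⟨-, J, _, _, _, x, hx, rfl⟩ := hψ
    set ψ : X → unitInterval := fun z => ⨆ i : J, ⨅ (j : J) (_ : i ≤ j), α.rel z (x j)
    refine T.le_of_iSup_eq_one hx fun i => ?_
    -- A Scott closed weight that is `1` on a tail of the net dominates `ψ`, hence is `1` at the
    -- supremum `a`. Closedness of `φ` then bounds `φ a` below by its infimum over the tail.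
    have h1 : 1 ≤ α.scottApproach.dist a (x '' Set.Ici i) := by
      refine le_scottApproach_dist_iff.2 fun ζ hζ hA => ?_
      refine le_trans ?_ (((isScottClosed_iff _ _).1 hζ).2 ψ hψ' a ha)
      refine (T.le_sub_iff _ _ _).2 fun y => ?_
      rw [T.mul_one]
      refine iSup_le fun k => ?_
      obtain ⟨j, hkj, hij⟩ := exists_ge_ge k i
      refine (iInf₂_le j hkj).trans ?_
      have h2 := hζ.1 y (x j)
      rwa [le_antisymm unitInterval.le_one' (hA _ (Set.mem_image_of_mem x hij)),
        T.one_mul] at h2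
    have h3 := h a (x '' Set.Ici i)
    rw [le_antisymm unitInterval.le_one' h1, T.mul_one, iInf_image] at h3
    refine le_trans (le_iInf₂ fun j hj => ?_) h3
    refine le_trans (T.mul_mono' ?_ le_rfl) (T.mul_sub_le ψ φ (x j))
    refine le_iSup_of_le j (le_iInf₂ fun l hl => ?_)
    exact iInf_le_of_le j (iInf_le_of_le l (iInf_le_of_le hj (iInf_le _ hl)))

theorem preservesOrder_of_isContinuous_scottApproach {α : EnrichedOrder T X}
    {ε : ApproachStructure T Y} {f : X → Y} (hf : α.scottApproach.IsContinuous ε f) :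
    PreservesOrder α ε.specialization f := fun x y => by
  have h := hf x {y}
  rw [Set.image_singleton] at h
  refine le_trans (le_scottApproach_dist_iff.2 fun ζ hζ h1 => ?_) h
  have h2 := hζ.1 x y
  rwa [le_antisymm unitInterval.le_one' (h1 y rfl), T.one_mul] at h2

theorem preservesOrder_powerOrder {δ : ApproachStructure T X} {I : Type u}
    {e : X → I → unitInterval} (he : ∀ i, δ.IsClosedFun fun x => e x i) :
    PreservesOrder δ.specialization (powerOrder T I) e := fun x y =>
  (T.le_sub_iff _ _ _).2 fun i => (he i).isWeight x y

/-- With `w` way above `e x` and `q = δ(x,A)`, some `a ∈ A` has `q & e a i < w i` at all coordinates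
where `w i ≠ 1`. Enlarging `e a` slightly there gives `u` way above `e a` with `q & u ≤ w`, and the
weight law for `f` passes from `u` to `w`. -/
theorem isClosedFun_iInf_wayAbove {δ : ApproachStructure T X} {I : Type u}
    {e : X → I → unitInterval} (he : ∀ i, δ.IsClosedFun fun x => e x i)
    {f : (I → unitInterval) → unitInterval} (hf : (powerOrder T I).IsWeight f) :
    δ.IsClosedFun fun x => ⨅ w : {w // WayAbove (e x) w}, f w := by
  classical
  intro x A
  refine le_iInf fun ⟨w, hw⟩ => ?_
  set q := δ.dist x A
  by_cases hq0 : q = 0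
  · rw [hq0, T.mul_zero]
    exact unitInterval.nonneg'
  obtain ⟨a, ha, h⟩ : ∃ a ∈ A, ∀ i, w i ≠ 1 → T.mul q (e a i) < w i := by
    -- Otherwise `A` is a finite union of sets on each of which a fixed coordinate fails. One of
    -- them has `δ`-value at least `q` at `x`, which contradicts closedness of that coordinate.
    by_contra! hcon
    have hA : A ⊆ ⋃ i ∈ {i | w i ≠ 1}, {a | a ∈ A ∧ w i ≤ T.mul q (e a i)} := fun a ha => by
      obtain ⟨i, hi, h⟩ := hcon a ha
      exact Set.mem_biUnion hi ⟨ha, h⟩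
    rcases δ.exists_dist_le_of_subset_biUnion hw.1 x _ hA with h | ⟨i, hi, h⟩
    · exact hq0 h
    · set B := {a | a ∈ A ∧ w i ≤ T.mul q (e a i)}
      have h1 : T.mul q (⨅ b ∈ B, e b i) < w i := by
        rw [T.mul_comm]
        exact ((T.mul_mono _ _ _ h).trans (he i x B)).trans_lt (hw.2 i hi)
      obtain ⟨s, hs, hqs⟩ := T.exists_mul_lt h1
      obtain ⟨b, hb, hbs⟩ : ∃ b ∈ B, e b i ≤ s := by
        by_cases hs1 : s = 1
        -- When `s = 1` any point of `B` serves; `B` is nonempty because `q ≠ 0`.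
        · obtain ⟨b, hb⟩ : B.Nonempty := by
            rw [Set.nonempty_iff_ne_empty]
            intro hB0
            rw [hB0, δ.dist_empty] at h
            exact hq0 (le_antisymm h unitInterval.nonneg')
          exact ⟨b, hb, hs1 ▸ unitInterval.le_one'⟩
        · by_contra! hcon
          exact (hs hs1).not_ge (le_iInf₂ fun b hb => (hcon b hb).le)
      exact ((T.mul_mono _ _ _ hbs).trans_lt hqs).not_ge hb.2
  have h' := fun i (hi : w i ≠ 1) => T.exists_mul_lt (h i hi)
  choose! v hv hvq using h'
  have hu : WayAbove (e a) fun i => if w i = 1 then 1 else v i := by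
    refine ⟨hw.1.subset fun i hi => ?_, fun i hi => ?_⟩
    · intro h1
      exact hi (if_pos h1)
    · by_cases h1 : w i = 1
      · exact absurd (if_pos h1) hi
      · simp only [if_neg h1] at hi ⊢
        exact hv i h1 hi
  refine le_trans (T.mul_mono' ((iInf₂_le a ha).trans (iInf_le _ ⟨_, hu⟩)) ?_) (hf w _)
  refine (T.le_sub_iff _ _ _).2 fun i => ?_
  by_cases h1 : w i = 1
  · rw [h1]
    exact unitInterval.le_one'
  · simp only [if_neg h1]
    rw [T.mul_comm]
    exact (hvq i h1).le

/-! ### Separated retracts of a power, and the existence of the retraction. -/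

section Retract

variable {X : Type u} {δ : ApproachStructure T X} {I : Type u} {e : X → I → unitInterval}
  {r : (I → unitInterval) → X}

/-- `φ ∘ r` is closed, hence Scott closed, on the power. The image weight has an explicit supremum
there, and `r` sends it to `a` by uniqueness of suprema. -/
theorem IsClosedFun.isScottClosed_of_retract (hsep : δ.IsSeparated)
    (he : ∀ i, δ.IsClosedFun fun x => e x i)
    (hr : (powerOrder T I).scottApproach.IsContinuous δ r) (hre : ∀ x, r (e x) = x)
    {φ : X → unitInterval} (h : δ.IsClosedFun φ) : δ.specialization.IsScottClosed φ := by
  refine (isScottClosed_iff _ _).2 ⟨h.isWeight, fun ψ hψ a ha => ?_⟩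
  have hφr := (isScottClosed_iff _ _).1 (h.comp hr).isScottClosed
  have heo := preservesOrder_powerOrder he
  have hs := powerOrder_isSupremum T (push T (powerOrder T I) e ψ)
  have h1 := hφr.2 _ (hψ.push heo) _ hs
  rw [sub_push e ψ hφr.1] at h1
  simp only [hre] at h1
  rwa [(hs.of_retract heo (preservesOrder_of_isContinuous_scottApproach hr) hre).unique hsep ha]
    at h1

/-- The approximating weight of `x` in a retract of a power of `[0,1]`. -/
theorem isForwardCauchyWeight_wayAbove
    (hr : (powerOrder T I).scottApproach.IsContinuous δ r) (z : I → unitInterval) :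
    δ.specialization.IsForwardCauchyWeight fun y =>
      ⨆ w : {w // WayAbove z w}, δ.specialization.rel y (r w) :=
  δ.specialization.isForwardCauchyWeight_iSup_rel
    (J := {w : I → unitInterval // WayAbove z w}ᵒᵈ) (fun w => r w.ofDual.1) fun _ _ hvw =>
      (powerOrder_rel_of_le T hvw).trans (preservesOrder_of_isContinuous_scottApproach hr _ _)

/-- The point `z` lies below the supremum of the directed family of points way above it, and a Scott
closed weight respects that supremum. -/
theorem powerOrder_iInf_wayAbove_le {φ : (I → unitInterval) → unitInterval}
    (h : (powerOrder T I).IsScottClosed φ) (z : I → unitInterval) :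
    ⨅ w : {w // WayAbove z w}, φ w ≤ φ z := by
  have h' := (isScottClosed_iff _ _).1 h
  have hd : (powerOrder T I).IsForwardCauchyWeight fun y =>
      ⨆ w : {w // WayAbove z w}, (powerOrder T I).rel y w :=
    (powerOrder T I).isForwardCauchyWeight_iSup_rel
      (J := {w : I → unitInterval // WayAbove z w}ᵒᵈ) (fun w => w.ofDual.1) fun _ _ hvw =>
        powerOrder_rel_of_le T hvw
  rw [← sub_iSup_rel (fun w : {w // WayAbove z w} => w.1) h'.1]
  refine (h'.2 _ hd _ (powerOrder_isSupremum T _)).trans ?_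
  have h1 : 1 ≤ (powerOrder T I).rel z fun i =>
      T.sub (fun y => ⨆ w : {w // WayAbove z w}, (powerOrder T I).rel y w) fun x => x i := by
    refine (T.le_sub_iff _ _ _).2 fun i => ?_
    rw [T.mul_one, sub_iSup_rel (fun w : {w // WayAbove z w} => w.1)
      (powerOrder_isWeight_eval T i)]
    exact le_apply_of_forall_wayAbove fun w hw => iInf_le_of_le ⟨w, hw⟩ le_rfl
  refine le_trans ?_ (h'.1 z fun i =>
    T.sub (fun y => ⨆ w : {w // WayAbove z w}, (powerOrder T I).rel y w) fun x => x i)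
  rw [le_antisymm unitInterval.le_one' h1, T.mul_one]

theorem isSupremum_wayAbove
    (hr : (powerOrder T I).scottApproach.IsContinuous δ r) (hre : ∀ x, r (e x) = x) (x : X) :
    δ.specialization.IsSupremum
      (fun y => ⨆ w : {w // WayAbove (e x) w}, δ.specialization.rel y (r w)) x := by
  intro y
  rw [sub_iSup_rel (fun w : {w // WayAbove (e x) w} => r w.1)
    (φ := fun z => δ.specialization.rel z y) fun z w => δ.specialization.trans z w y]
  refine le_antisymm (le_iInf fun w => ?_) ?_
  · have hle : e x ≤ w.1 := fun i => by
      by_cases hi : w.1 i = 1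
      · exact hi ▸ unitInterval.le_one'
      · exact (w.2.2 i hi).le
    have h1 := (powerOrder_rel_of_le T hle).trans
      (preservesOrder_of_isContinuous_scottApproach hr w.1 (e x))
    rw [hre] at h1
    refine le_trans ?_ (δ.specialization.trans (r w.1) x y)
    rw [le_antisymm unitInterval.le_one' h1, T.mul_one]
  -- The function `z ↦ δ(r z, {y})` is Scott closed on the power, so its value at `e x` is
  -- controlled by the points way above `e x`.
  · have h := powerOrder_iInf_wayAbove_le
      ((δ.isClosedFun_dist {y}).comp hr).isScottClosed (e x)
    rwa [hre] at h

theorem isContinuousLattice_of_retract (hsep : δ.IsSeparated)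
    (he : ∀ i, δ.IsClosedFun fun x => e x i)
    (hr : (powerOrder T I).scottApproach.IsContinuous δ r) (hre : ∀ x, r (e x) = x) :
    δ.specialization.IsContinuousLattice := by
  have heo := preservesOrder_powerOrder he
  have hro := preservesOrder_of_isContinuous_scottApproach hr
  refine ⟨⟨hsep, (powerOrder_isComplete T I).of_retract heo.op hro.op hre⟩, hsep,
    fun ψ => r fun i => T.sub (push T (powerOrder T I) e ψ.1) fun x => x i,
    fun x => ⟨_, isForwardCauchyWeight_wayAbove hr (e x)⟩, ?_, ?_⟩
  · exact fun ψ => (powerOrder_isSupremum T _).of_retract heo hro hre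
  · intro x ψ
    set s := fun i => T.sub (push T (powerOrder T I) e ψ.1) fun x => x i
    have hsup : δ.specialization.IsSupremum ψ.1 (r s) :=
      (powerOrder_isSupremum T _).of_retract heo hro hre
    change T.sub _ ψ.1 = _
    rw [sub_iSup_rel (fun w : {w // WayAbove (e x) w} => r w.1) ψ.2.1]
    refine le_antisymm ?_ (le_iInf fun w => ?_)
    · rw [isSupremum_wayAbove hr hre x, sub_iSup_rel (fun w : {w // WayAbove (e x) w} => r w.1)
        (φ := fun z => δ.specialization.rel z (r s)) fun z w => δ.specialization.trans z w _]
      exact iInf_mono fun w => hsup.le_rel _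
    -- Coordinates are Scott closed on `X`, so `e (r s)` lies below `s`; this is the nontrivial half
    -- of `e` preserving the supremum of `ψ`.
    · have h1 : 1 ≤ (powerOrder T I).rel (e (r s)) s := by
        refine (T.le_sub_iff _ _ _).2 fun i => ?_
        change T.mul (T.sub _ _) 1 ≤ _
        rw [T.mul_one, sub_push e ψ.1 (powerOrder_isWeight_eval T i)]
        exact ((isScottClosed_iff _ _).1
          ((he i).isScottClosed_of_retract hsep he hr hre)).2 ψ.1 ψ.2 _ hsup
      calc δ.specialization.rel x (r s) ≤ (powerOrder T I).rel (e x) (e (r s)) := heo _ _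
        _ = T.mul 1 ((powerOrder T I).rel (e x) (e (r s))) := (T.one_mul _).symm
        _ ≤ (powerOrder T I).rel (e x) s :=
          (T.mul_mono' h1 le_rfl).trans ((powerOrder T I).trans _ _ _)
        _ ≤ push T (powerOrder T I) e ψ.1 w := powerOrder_rel_supremum_le (ψ.2.push heo) w.2
        _ ≤ ψ.1 (r w) := iSup_le fun y => by
          refine le_trans (T.mul_mono _ _ _ (hro _ _)) ?_
          rw [hre]
          exact ψ.2.1 _ _

theorem eq_scottApproach_of_retract (hsep : δ.IsSeparated)
    (he : ∀ i, δ.IsClosedFun fun x => e x i)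
    (hr : (powerOrder T I).scottApproach.IsContinuous δ r) (hre : ∀ x, r (e x) = x) :
    δ = δ.specialization.scottApproach := by
  have hro := preservesOrder_of_isContinuous_scottApproach hr
  ext1
  funext x A
  refine le_antisymm (le_scottApproach_dist_iff.2 fun φ hφ hA => ?_) ?_
  · have hφ' := (isScottClosed_iff _ _).1 hφ
    have hw : (powerOrder T I).IsWeight fun z => φ (r z) := fun y z =>
      (T.mul_mono _ _ _ (hro y z)).trans (hφ'.1 _ _)
    have hsub : ∀ y, T.sub
        (fun z => ⨆ w : {w // WayAbove (e y) w}, δ.specialization.rel z (r w)) φ =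
          ⨅ w : {w // WayAbove (e y) w}, φ (r w) := fun y =>
      sub_iSup_rel (fun w : {w // WayAbove (e y) w} => r w.1) hφ'.1
    -- This closed function is `1` on `A`, so it dominates `δ(-,A)`. It is at most `φ` because each
    -- point is the supremum of its approximating weight.
    have h1 := isClosedFun_iInf_wayAbove he hw x A
    have h2 : ∀ a ∈ A, 1 ≤ ⨅ w : {w // WayAbove (e a) w}, φ (r w) := fun a ha => by
      rw [← hsub, T.le_sub_iff]
      intro y
      rw [T.mul_one]
      refine ((isSupremum_wayAbove hr hre a).le_rel y).trans ?_
      have h3 := hφ'.1 y a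
      rwa [le_antisymm unitInterval.le_one' (hA a ha), T.one_mul] at h3
    rw [le_antisymm unitInterval.le_one' (le_iInf₂ h2), T.one_mul] at h1
    exact (h1.trans (hsub x).ge).trans (hφ'.2 _ (isForwardCauchyWeight_wayAbove hr (e x)) x
      (isSupremum_wayAbove hr hre x))
  · have hle := le_scottApproach_dist_iff.1
      (le_refl (δ.specialization.scottApproach.dist x A))
    refine hle _ ((δ.isClosedFun_dist A).isScottClosed_of_retract hsep he hr hre) fun a ha => ?_
    exact (δ.dist_singleton a).trans (δ.dist_mono a (Set.singleton_subset_iff.2 ha))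

/-- A separated injective `[0,1]`-approach space is a retract of a power of `[0,1]`. -/
theorem IsInjective.exists_retract (hsep : δ.IsSeparated) (hinj : δ.IsInjective) :
    ∃ r : (Set X → unitInterval) → X,
      (powerOrder T (Set X)).scottApproach.IsContinuous δ r ∧ ∀ x, r (δ.dist x) = x := by
  have hone : ∀ a A, a ∈ A → 1 ≤ δ.dist a A := fun a A ha =>
    (δ.dist_singleton a).trans (δ.dist_mono a (Set.singleton_subset_iff.2 ha))
  have hinj' : Function.Injective δ.dist := fun x y hxy =>
    hsep x y (le_inf ((hone y {y} rfl).trans_eq (congrFun hxy {y}).symm)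
      ((hone x {x} rfl).trans_eq (congrFun hxy {x})))
  obtain ⟨r, hr, h⟩ := hinj _ (powerOrder T (Set X)).scottApproach (Set.range δ.dist)
    (fun z => z.2.choose) fun z A => by
      have hz : ∀ z : Set.range δ.dist, δ.dist z.2.choose = z.1 := fun z => z.2.choose_spec
      set B := (fun z : Set.range δ.dist => z.2.choose) '' A
      change (powerOrder T (Set X)).scottApproach.dist z.1 _ ≤ δ.dist z.2.choose B
      rw [hz]
      -- Evaluation at `B` is `1` on the image of `A`, and at `z` it is exactly the required bound.
      refine le_scottApproach_dist_iff.1 le_rfl _ (powerOrder_isScottClosed_eval T B) ?_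
      rintro _ ⟨a, ha, rfl⟩
      rw [← hz]
      exact hone _ _ (Set.mem_image_of_mem _ ha)
  refine ⟨r, hr, fun x => ?_⟩
  have hx : δ.dist x ∈ Set.range δ.dist := ⟨x, rfl⟩
  rw [h ⟨δ.dist x, hx⟩]
  exact hinj' hx.choose_spec

end Retract

end ApproachStructure

theorem mainTheorem1 (T : ContinuousTNorm) {X : Type u} (δ : ApproachStructure T X)
    (hsep : δ.IsSeparated) (hinj : δ.IsInjective) :
    δ.specialization.IsContinuousLattice ∧ δ = δ.specialization.scottApproach := by
  obtain ⟨r, hr, hre⟩ := hinj.exists_retract hsep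
  exact ⟨ApproachStructure.isContinuousLattice_of_retract hsep δ.isClosedFun_dist hr hre,
    ApproachStructure.eq_scottApproach_of_retract hsep δ.isClosedFun_dist hr hre⟩
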